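/- The equation \[ (1+\vartheta)\log(1+\vartheta^{-1})+\frac{\log\vartheta}{1+\vartheta}=1 \] has a unique positive root $\vartheta$. Put $\lambda_0=e(1+\vartheta^{-1})^{-\vartheta}$; then $1.7336105\le\lambda_0<1.7336106$. For every real number $\lambda<\lambda_0$ there is an integer $N$, depending only on $\lambda$, such that the following holds for every $n\ge N$. Let $x_1,\dots,x_n>0$ be the roots, listed with multiplicity, of a monic irreducible polynomial of degree $n$ in $\mathbb{Z}[x]$, and assume that the $\binom n2$ numbers $(x_i-x_j)^2$, $1\le i<j\le n$, are pairwise distinct. Then the potential energy \[ E=\sum_{1\le i<j\le n}(x_i-x_j)^2 \] satisfies \[ E\ge\lambda\binom n2 . \] -/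

import Mathlib

open Polynomial

/-- The potential energy `∑_{i < j} (x_i - x_j)²` of the real numbers `x_1, …, x_n`. -/
noncomputable def potentialEnergy {n : ℕ} (x : Fin n → ℝ) : ℝ :=
  ∑ q : Fin n × Fin n with q.1 < q.2, (x q.1 - x q.2) ^ 2

/-- `t` is a positive root of `(1 + t) log (1 + t⁻¹) + log t / (1 + t) = 1`. -/
def IsSiegelRoot (t : ℝ) : Prop :=
  0 < t ∧ (1 + t) * Real.log (1 + t⁻¹) + Real.log t / (1 + t) = 1

/-- The number `e (1 + t⁻¹)^(-t)`. -/
noncomputable def siegelConstant (t : ℝ) : ℝ :=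
  Real.exp 1 * (1 + t⁻¹) ^ (-t)

/-!
The numbers `(x_i - x_j)²`, indexed by the `m = n.choose 2` pairs, are distinct and positive. Their
product and the product of their mutual differences are nonzero symmetric integer polynomials in the
roots `x_i` of a monic integer polynomial, hence integers of absolute value at least `1`
(`one_le_abs_aeval_of_isSymmetric`). So Siegel's lower bound for the trace of a totally positive
algebraic integer applies to them, with the same proof, even if they are not all conjugate
(`siegel_trace_bound`).

For points `y_1, …, y_m > 0` the discriminant is the square of a Vandermonde determinant, which is
unchanged when the monomials are replaced by the monic Laguerre polynomials `P_k` with parameter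
`a`. The uniform bound `P_k(y)² y^a e^{-y} ≤ k! (k + a)!` (`monicLaguerre_sq_mul_pow_le`) holds
because the Laguerre functions are matrix coefficients of the unitary displacement operators on the
Bargmann–Fock space: the coefficients of `(w - x)^k e^{xw}` have weighted square sum `k! e^{x²}`
(`hasSum_displacedCoeff_sq`), and one of them is `P_k(x²)` up to a factor. Hence
`disc(y) * (∏ y_i)^a * e^{-∑ y_i} ≤ (m!)² ∏_{k < m} k! (k + a)!`
(`prod_abs_sub_mul_prod_pow_le`).

Apply this to the points `γ m y_i` with `a ∼ θ m`, where `θ` is the root of Siegel's equation, and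
evaluate the factorials with Stirling's formula. In the limit this bounds `∑ y_i / m` below by
`siegelConstant θ` for `γ = (1 + θ) / siegelConstant θ` (`siegelRoot_identity`). The root is unique
because the left side of the equation is increasing on `(0, 1]` and exceeds `1` from there on; the
decimal bounds follow from an enclosure of the root, since `siegelConstant` is decreasing.
-/

/-! ### Monic Laguerre polynomials and their uniform bound -/

/-- The coefficient of `w ^ j` in the power series `(w - x) ^ k * exp (x * w)`. -/
noncomputable def displacedCoeff (x : ℝ) : ℕ → ℕ → ℝ
  | 0, j => x ^ j / (j.factorial : ℝ)
  | k + 1, 0 => -x * displacedCoeff x k 0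
  | k + 1, j + 1 => displacedCoeff x k j - x * displacedCoeff x k (j + 1)

/-- Differentiating `(w - x) ^ (k + 1) * exp (x * w)` in `w`, coefficient by coefficient. -/
lemma displacedCoeff_deriv (x : ℝ) (k j : ℕ) :
    ((j : ℝ) + 1) * displacedCoeff x (k + 1) (j + 1) =
      x * displacedCoeff x (k + 1) j + (k + 1) * displacedCoeff x k j := by
  have h0 (j : ℕ) : ((j : ℝ) + 1) * displacedCoeff x 0 (j + 1) = x * displacedCoeff x 0 j := by
    simp only [displacedCoeff, Nat.factorial_succ]
    push_cast
    have : (j.factorial : ℝ) ≠ 0 := by positivity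
    field_simp
    ring
  have hz (k : ℕ) : displacedCoeff x (k + 1) 0 = -x * displacedCoeff x k 0 := by
    rw [displacedCoeff]
  have hs (k j : ℕ) : displacedCoeff x (k + 1) (j + 1) =
      displacedCoeff x k j - x * displacedCoeff x k (j + 1) := by rw [displacedCoeff]
  induction k generalizing j with
  | zero =>
    cases j with
    | zero =>
      have h1 := h0 0
      push_cast at *
      linear_combination hs 0 0 - x * hz 0 - x * h1
    | succ j =>
      have h1 := h0 j
      have h2 := h0 (j + 1)
      push_cast at *
      linear_combination h1 - x * h2 + ((j : ℝ) + 2) * hs 0 (j + 1) - x * hs 0 j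
  | succ k ih =>
    cases j with
    | zero =>
      have h1 := ih 0
      push_cast at *
      linear_combination (-x) * h1 + hs (k + 1) 0 - x * hz (k + 1) - ((k : ℝ) + 1) * hz k
    | succ j =>
      have h1 := ih j
      have h2 := ih (j + 1)
      push_cast at *
      linear_combination h1 - x * h2 + ((j : ℝ) + 2) * hs (k + 1) (j + 1) - x * hs (k + 1) j -
        ((k : ℝ) + 1) * hs k j

/-- A crude bound, used for the convergence to `0` of boundary terms. -/
lemma exists_abs_displacedCoeff_le (x : ℝ) (k : ℕ) :
    ∃ C R : ℝ, 0 ≤ C ∧ 0 ≤ R ∧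
      ∀ j, |displacedCoeff x k j| ≤ C * R ^ j / (j.factorial : ℝ) := by
  induction k with
  | zero =>
    refine ⟨1, |x|, zero_le_one, abs_nonneg x, fun j => ?_⟩
    simp [displacedCoeff, abs_div, abs_pow]
  | succ k ih =>
    obtain ⟨C, R, hC, hR, h⟩ := ih
    -- Doubling `R` absorbs the factor `j + 1 ≤ 2 ^ (j + 1)` from `1 / j! = (j + 1) / (j + 1)!`.
    refine ⟨C * (1 + |x|), 2 * (R + 1), by positivity, by positivity, fun j => ?_⟩
    cases j with
    | zero =>
      have h1 := h 0
      simp only [displacedCoeff, abs_mul, abs_neg, pow_zero, Nat.factorial_zero, Nat.cast_one,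
        div_one, mul_one] at *
      nlinarith [abs_nonneg x]
    | succ j =>
      have h1 := h j
      have h2 := h (j + 1)
      have hf : (0 : ℝ) < ((j + 1).factorial : ℝ) := by positivity
      have hj : ((j : ℝ) + 1) ≤ 2 ^ (j + 1) := by
        exact_mod_cast (Nat.lt_two_pow_self (n := j + 1)).le
      have e1 : C * R ^ j / (j.factorial : ℝ) = C * R ^ j * (j + 1) / ((j + 1).factorial : ℝ) := by
        rw [Nat.factorial_succ]
        push_cast
        have : (j.factorial : ℝ) ≠ 0 := by positivity
        field_simp
      have p1 : R ^ j ≤ (R + 1) ^ (j + 1) :=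
        (pow_le_pow_left₀ hR (by linarith) j).trans (pow_le_pow_right₀ (by linarith) (by omega))
      have p2 : R ^ (j + 1) ≤ (2 * (R + 1)) ^ (j + 1) := pow_le_pow_left₀ hR (by linarith) _
      have p3 : R ^ j * (j + 1) ≤ (2 * (R + 1)) ^ (j + 1) := by
        rw [mul_pow, mul_comm]
        gcongr
      rw [displacedCoeff]
      calc _ ≤ |displacedCoeff x k j| + |x| * |displacedCoeff x k (j + 1)| := by
            rw [← abs_mul]; exact abs_sub _ _
        _ ≤ C * R ^ j / (j.factorial : ℝ) + |x| * (C * R ^ (j + 1) / ((j + 1).factorial : ℝ)) := by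
            gcongr
        _ = C * (R ^ j * (j + 1) + |x| * R ^ (j + 1)) / ((j + 1).factorial : ℝ) := by
            rw [e1]; ring
        _ ≤ C * ((2 * (R + 1)) ^ (j + 1) + |x| * (2 * (R + 1)) ^ (j + 1)) /
              ((j + 1).factorial : ℝ) := by gcongr
        _ = _ := by ring

open Finset Filter Topology in
/-- The boundary term that appears when `w` and `d/dw` are moved across the inner product. -/
lemma tendsto_factorial_mul_displacedCoeff_mul (x : ℝ) (k : ℕ) :
    Tendsto (fun j : ℕ => (j.factorial : ℝ) * displacedCoeff x k j * displacedCoeff x (k + 1) j)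
      atTop (𝓝 0) := by
  obtain ⟨C, R, hC, hR, h⟩ := exists_abs_displacedCoeff_le x k
  obtain ⟨C', R', hC', hR', h'⟩ := exists_abs_displacedCoeff_le x (k + 1)
  have ht := (FloorSemiring.tendsto_pow_div_factorial_atTop (R * R')).const_mul (C * C')
  rw [mul_zero] at ht
  refine squeeze_zero_norm (fun j => ?_) ht
  have hf : (0 : ℝ) < (j.factorial : ℝ) := by positivity
  rw [Real.norm_eq_abs, abs_mul, abs_mul, abs_of_pos hf]
  calc _ ≤ (j.factorial : ℝ) * (C * R ^ j / (j.factorial : ℝ)) *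
        (C' * R' ^ j / (j.factorial : ℝ)) := by
        gcongr
        exacts [h j, h' j]
    _ = _ := by
        rw [mul_pow]
        field_simp

open Finset Filter Topology in
/-- The squared norm of `(w - x) ^ k * exp (x * w)` in the Bargmann–Fock space, in which `w ^ j`
has squared norm `j!`, equals `k! * exp (x ^ 2)`. The induction uses that multiplication by `w`
is adjoint to `d/dw`. -/
lemma hasSum_displacedCoeff_sq (x : ℝ) (k : ℕ) :
    HasSum (fun j : ℕ => (j.factorial : ℝ) * displacedCoeff x k j ^ 2)
      (k.factorial * Real.exp (x ^ 2)) := by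
  induction k with
  | zero =>
    have h := NormedSpace.expSeries_div_hasSum_exp (𝔸 := ℝ) (x ^ 2)
    rw [← Real.exp_eq_exp_ℝ] at h
    simp only [Nat.factorial_zero, Nat.cast_one, one_mul]
    have hfun : (fun j : ℕ => (j.factorial : ℝ) * displacedCoeff x 0 j ^ 2) =
        fun j => (x ^ 2) ^ j / (j.factorial : ℝ) := by
      funext j
      have : (j.factorial : ℝ) ≠ 0 := by positivity
      simp only [displacedCoeff]
      field_simp
      ring
    rw [hfun]
    exact h
  | succ k ih =>
    rw [hasSum_iff_tendsto_nat_of_nonneg (fun j => by positivity), ← tendsto_add_atTop_iff_nat 1]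
    -- The adjointness computation, truncated at `J`; the last term is the boundary term.
    have hpart (J : ℕ) : ∑ j ∈ range (J + 1), (j.factorial : ℝ) * displacedCoeff x (k + 1) j ^ 2 =
        (k + 1) * ∑ j ∈ range J, (j.factorial : ℝ) * displacedCoeff x k j ^ 2 -
          x * ((J.factorial : ℝ) * displacedCoeff x k J * displacedCoeff x (k + 1) J) := by
      induction J with
      | zero => simp [displacedCoeff]; ring
      | succ J ihJ =>
        rw [sum_range_succ, ihJ, sum_range_succ]
        have h1 := displacedCoeff_deriv x k J
        rw [Nat.factorial_succ]
        have h2 : displacedCoeff x (k + 1) (J + 1) =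
          displacedCoeff x k J - x * displacedCoeff x k (J + 1) := by rw [displacedCoeff]
        push_cast
        linear_combination (J.factorial : ℝ) * displacedCoeff x k J * h1 +
          ((J : ℝ) + 1) * (J.factorial : ℝ) * displacedCoeff x (k + 1) (J + 1) * h2
    simp_rw [hpart]
    have h := (ih.tendsto_sum_nat.const_mul ((k : ℝ) + 1)).sub
      ((tendsto_factorial_mul_displacedCoeff_mul x k).const_mul x)
    convert h using 2
    rw [Nat.factorial_succ]
    push_cast
    ring

/-- The Laguerre polynomial `L_k^{(a)}`, normalised to be monic, defined by the recursion that
`displacedCoeff` satisfies along the diagonals `j = k + a`. -/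
noncomputable def monicLaguerre : ℕ → ℕ → ℝ[X]
  | 0, _ => 1
  | k + 1, a => X * monicLaguerre k (a + 1) - C ((k : ℝ) + 1 + a) * monicLaguerre k a

lemma monicLaguerre_monic_natDegree (k a : ℕ) :
    (monicLaguerre k a).Monic ∧ (monicLaguerre k a).natDegree = k := by
  induction k generalizing a with
  | zero => simp [monicLaguerre]
  | succ k ih =>
    obtain ⟨m1, d1⟩ := ih (a + 1)
    obtain ⟨m0, d0⟩ := ih a
    have hm : (X * monicLaguerre k (a + 1)).Monic := monic_X.mul m1
    have hd : (X * monicLaguerre k (a + 1)).natDegree = k + 1 := by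
      rw [monic_X.natDegree_mul m1, natDegree_X, d1, add_comm]
    have hlt : (C ((k : ℝ) + 1 + a) * monicLaguerre k a).degree <
        (X * monicLaguerre k (a + 1)).degree := by
      rw [degree_eq_natDegree hm.ne_zero, hd]
      refine lt_of_le_of_lt degree_le_natDegree ?_
      exact_mod_cast lt_of_le_of_lt (natDegree_C_mul_le _ _) (by omega)
    rw [monicLaguerre]
    exact ⟨hm.sub_of_left hlt, (natDegree_sub_eq_left_of_natDegree_lt (by
      rw [hd]; exact lt_of_le_of_lt (natDegree_C_mul_le _ _) (by omega))).trans hd⟩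

/-- The Laguerre functions are the matrix coefficients of a unitary operator in the orthogonal
basis `w ^ j`. -/
lemma displacedCoeff_eq_monicLaguerre (x : ℝ) (k a : ℕ) :
    displacedCoeff x k (k + a) =
      (-1) ^ k * x ^ a / ((k + a).factorial : ℝ) * (monicLaguerre k a).eval (x ^ 2) := by
  induction k generalizing a with
  | zero => simp [displacedCoeff, monicLaguerre]
  | succ k ih =>
    have h0 := ih a
    have h1 := ih (a + 1)
    rw [show k + (a + 1) = k + a + 1 by ring] at h1
    rw [show k + 1 + a = k + a + 1 by ring, displacedCoeff, h0, h1, monicLaguerre]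
    simp only [Nat.factorial_succ, eval_sub, eval_mul, eval_X, eval_C]
    have : ((k + a).factorial : ℝ) ≠ 0 := by positivity
    have : ((k : ℝ) + a + 1) ≠ 0 := by positivity
    push_cast
    field_simp
    ring

/-- The Laguerre functions are bounded by their `L²`-norm: the left side, divided by
`k! (k + a)! exp y`, is a single term of a series of nonnegative terms with sum `1`. -/
lemma monicLaguerre_sq_mul_pow_le (k a : ℕ) {y : ℝ} (hy : 0 ≤ y) :
    (monicLaguerre k a).eval y ^ 2 * y ^ a ≤
      k.factorial * (k + a).factorial * Real.exp y := by
  have h := hasSum_displacedCoeff_sq (√y) k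
  have h1 := le_hasSum h (k + a) (fun j _ => by positivity)
  rw [displacedCoeff_eq_monicLaguerre, Real.sq_sqrt hy] at h1
  have hf : (0 : ℝ) < ((k + a).factorial : ℝ) := by positivity
  have hs : (√y ^ a) ^ 2 = y ^ a := by rw [← pow_mul, mul_comm, pow_mul, Real.sq_sqrt hy]
  have hsgn : (((-1 : ℝ)) ^ k) ^ 2 = 1 := by rw [← pow_mul, mul_comm, pow_mul]; simp
  have e : ((k + a).factorial : ℝ) * ((-1) ^ k * √y ^ a / ((k + a).factorial : ℝ) *
      (monicLaguerre k a).eval y) ^ 2 =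
      (monicLaguerre k a).eval y ^ 2 * y ^ a / ((k + a).factorial : ℝ) := by
    rw [mul_pow, div_pow, mul_pow, hs, hsgn]
    field_simp
  rw [e, div_le_iff₀ hf] at h1
  linarith

lemma log_one_add_inv {t : ℝ} (ht : 0 < t) :
    Real.log (1 + t⁻¹) = Real.log (1 + t) - Real.log t := by
  rw [← Real.log_div (by positivity) ht.ne']
  congr 1
  field_simp
  ring

lemma inv_one_add_lt_log {t : ℝ} (ht : 0 < t) : (1 + t)⁻¹ < Real.log (1 + t⁻¹) := by
  have h := Real.log_lt_sub_one_of_pos (x := t / (1 + t)) (by positivity)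
    (by rw [Ne, div_eq_one_iff_eq (by positivity)]; linarith)
  rw [Real.log_div ht.ne' (by positivity)] at h
  rw [log_one_add_inv ht]
  have : t / (1 + t) - 1 = -(1 + t)⁻¹ := by field_simp; ring
  linarith

/-- The left side of the equation defining `IsSiegelRoot`. -/
noncomputable def siegelFun (t : ℝ) : ℝ :=
  (1 + t) * Real.log (1 + t⁻¹) + Real.log t / (1 + t)

lemma hasDerivAt_log_one_add_inv {t : ℝ} (ht : 0 < t) :
    HasDerivAt (fun t : ℝ => Real.log (1 + t⁻¹)) (-(t * (1 + t))⁻¹) t := by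
  have h := ((hasDerivAt_inv ht.ne').const_add 1).log (by positivity)
  convert h using 1
  have : 1 + t ≠ 0 := by positivity
  field_simp
  ring

lemma hasDerivAt_siegelFun {t : ℝ} (ht : 0 < t) :
    HasDerivAt siegelFun
      (Real.log (1 + t⁻¹) - (1 + t)⁻¹ - Real.log t / (1 + t) ^ 2) t := by
  have h1 : HasDerivAt (fun t : ℝ => 1 + t) 1 t := (hasDerivAt_id t).const_add 1
  have h : HasDerivAt siegelFun _ t := (h1.mul (hasDerivAt_log_one_add_inv ht)).add
    ((Real.hasDerivAt_log ht.ne').div h1 (by positivity))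
  convert h using 1
  field_simp
  ring

lemma strictMonoOn_siegelFun : StrictMonoOn siegelFun (Set.Ioc 0 1) := by
  refine strictMonoOn_of_deriv_pos (convex_Ioc 0 1)
    (fun t ht => (hasDerivAt_siegelFun ht.1).continuousAt.continuousWithinAt) fun t ht => ?_
  rw [interior_Ioc] at ht
  rw [(hasDerivAt_siegelFun ht.1).deriv]
  have h1 := inv_one_add_lt_log ht.1
  have h2 : Real.log t / (1 + t) ^ 2 ≤ 0 :=
    div_nonpos_of_nonpos_of_nonneg (Real.log_nonpos ht.1.le ht.2.le) (by positivity)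
  linarith

/-- Siegel's equation has no root beyond `1`, although `siegelFun` is not monotone there. -/
lemma one_lt_siegelFun {t : ℝ} (ht : 1 ≤ t) : 1 < siegelFun t := by
  have h0 : 0 < t := by linarith
  have h1 := inv_one_add_lt_log h0
  have h2 : 0 ≤ Real.log t / (1 + t) := div_nonneg (Real.log_nonneg ht) (by positivity)
  have h3 : 1 < (1 + t) * Real.log (1 + t⁻¹) := by
    rwa [← inv_lt_iff_one_lt_mul₀' (by positivity)]
  unfold siegelFun
  linarith

lemma siegelConstant_eq_exp {t : ℝ} (ht : 0 < t) :
    siegelConstant t = Real.exp (1 - t * Real.log (1 + t⁻¹)) := by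
  rw [siegelConstant, Real.rpow_def_of_pos (by positivity), ← Real.exp_add]
  congr 1
  ring

lemma strictAntiOn_siegelConstant : StrictAntiOn siegelConstant (Set.Ioi 0) := by
  have hd (t : ℝ) (ht : 0 < t) : HasDerivAt (fun t : ℝ => t * Real.log (1 + t⁻¹))
      (Real.log (1 + t⁻¹) - (1 + t)⁻¹) t := by
    have h : HasDerivAt (fun t : ℝ => t * Real.log (1 + t⁻¹)) _ t :=
      (hasDerivAt_id' t).mul (hasDerivAt_log_one_add_inv ht)
    convert h using 1
    field_simp
    ring
  have hmono : StrictMonoOn (fun t : ℝ => t * Real.log (1 + t⁻¹)) (Set.Ioi 0) := by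
    refine strictMonoOn_of_deriv_pos (convex_Ioi 0)
      (fun t ht => (hd t ht).continuousAt.continuousWithinAt) fun t ht => ?_
    rw [interior_Ioi] at ht
    rw [(hd t ht).deriv]
    exact sub_pos.2 (inv_one_add_lt_log ht)
  intro s hs t ht hst
  rw [siegelConstant_eq_exp hs, siegelConstant_eq_exp ht, Real.exp_lt_exp]
  linarith [hmono hs ht hst]

/-- Taylor bounds for the logarithm of a number close to `1`, with five terms. -/
lemma abs_log_one_sub_add_le {u : ℝ} (hu : |u| ≤ 1 / 50) :
    |Real.log (1 - u) + (u + u ^ 2 / 2 + u ^ 3 / 3 + u ^ 4 / 4 + u ^ 5 / 5)| ≤ 1 / 10 ^ 10 := by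
  have h := Real.abs_log_sub_add_sum_range_le (x := u) (by linarith) 5
  simp only [Finset.sum_range_succ, Finset.sum_range_zero] at h
  rw [show Real.log (1 - u) + (u + u ^ 2 / 2 + u ^ 3 / 3 + u ^ 4 / 4 + u ^ 5 / 5) =
    0 + u ^ (0 + 1) / (((0 : ℕ) : ℝ) + 1) + u ^ (1 + 1) / (((1 : ℕ) : ℝ) + 1) +
      u ^ (2 + 1) / (((2 : ℕ) : ℝ) + 1) + u ^ (3 + 1) / (((3 : ℕ) : ℝ) + 1) +
      u ^ (4 + 1) / (((4 : ℕ) : ℝ) + 1) + Real.log (1 - u) by push_cast; ring]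
  refine h.trans ?_
  have h6 : |u| ^ 6 ≤ (1 / 50) ^ 6 := pow_le_pow_left₀ (abs_nonneg u) hu 6
  rw [div_le_iff₀ (by linarith)]
  norm_num at h6 hu ⊢
  linarith

open Real in
/-- The two abscissae enclose the root `0.3144808694…` of Siegel's equation, closely enough for
`siegelConstant` to stay between the two decimal bounds. -/
lemma siegel_root_numerics :
    siegelFun 0.31448086 < 1 ∧ 1 < siegelFun 0.314480875 ∧
      siegelConstant 0.31448086 < 1.7336106 ∧ 1.7336105 < siegelConstant 0.314480875 := by
  obtain ⟨l2, u2⟩ := abs_le.1 log_two_near_10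
  obtain ⟨l3, u3⟩ := abs_le.1 log_three_near_10
  obtain ⟨l5, u5⟩ := abs_le.1 log_five_near_10
  have key (s r : ℝ) (hs : 0 < s) (hr : 0 < r) (h : |1 - r / s| ≤ 1 / 50) :
      |log r - log s + ((1 - r / s) + (1 - r / s) ^ 2 / 2 + (1 - r / s) ^ 3 / 3 +
        (1 - r / s) ^ 4 / 4 + (1 - r / s) ^ 5 / 5)| ≤ 1 / 10 ^ 10 := by
    have := abs_log_one_sub_add_le h
    rwa [sub_sub_cancel, log_div hr.ne' hs.ne'] at this
  -- The numbers `5 / 16`, `4 / 3`, `216 / 125` are products of powers of `2`, `3`, `5` within `2%`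
  -- of the arguments of the logarithms.
  have e1 : log (5 / 16) = log 5 - 4 * log 2 := by
    rw [log_div (by norm_num) (by norm_num), show (16 : ℝ) = 2 ^ 4 by norm_num, log_pow]
    norm_num
  have e2 : log (4 / 3) = 2 * log 2 - log 3 := by
    rw [log_div (by norm_num) (by norm_num), show (4 : ℝ) = 2 ^ 2 by norm_num, log_pow]
    norm_num
  have e3 : log (216 / 125) = 3 * log 2 + 3 * log 3 - 3 * log 5 := by
    rw [log_div (by norm_num) (by norm_num), show (216 : ℝ) = 2 ^ 3 * 3 ^ 3 by norm_num,
      show (125 : ℝ) = 5 ^ 3 by norm_num, log_mul (by norm_num) (by norm_num), log_pow, log_pow,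
      log_pow]
    norm_num
  obtain ⟨a1, b1⟩ := abs_le.1 (key (5 / 16) 0.31448086 (by norm_num) (by norm_num)
    (by rw [abs_le]; norm_num))
  obtain ⟨a2, b2⟩ := abs_le.1 (key (5 / 16) 0.314480875 (by norm_num) (by norm_num)
    (by rw [abs_le]; norm_num))
  obtain ⟨a3, b3⟩ := abs_le.1 (key (4 / 3) (1 + 0.31448086) (by norm_num) (by norm_num)
    (by rw [abs_le]; norm_num))
  obtain ⟨a4, b4⟩ := abs_le.1 (key (4 / 3) (1 + 0.314480875) (by norm_num) (by norm_num)
    (by rw [abs_le]; norm_num))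
  obtain ⟨a5, b5⟩ := abs_le.1 (key (216 / 125) 1.7336106 (by norm_num) (by norm_num)
    (by rw [abs_le]; norm_num))
  obtain ⟨a6, b6⟩ := abs_le.1 (key (216 / 125) 1.7336105 (by norm_num) (by norm_num)
    (by rw [abs_le]; norm_num))
  rw [e1] at a1 b1 a2 b2
  rw [e2] at a3 b3 a4 b4
  rw [e3] at a5 b5 a6 b6
  rw [siegelConstant_eq_exp (by norm_num), siegelConstant_eq_exp (by norm_num),
    ← lt_log_iff_exp_lt (by norm_num), ← log_lt_iff_lt_exp (by norm_num), siegelFun, siegelFun,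
    log_one_add_inv (by norm_num), log_one_add_inv (by norm_num)]
  generalize log 0.31448086 = A at *
  generalize log 0.314480875 = B at *
  generalize log (1 + 0.31448086) = A' at *
  generalize log (1 + 0.314480875) = B' at *
  generalize log 1.7336106 = U at *
  generalize log 1.7336105 = V at *
  norm_num at *
  refine ⟨?_, ?_, ?_, ?_⟩ <;> linarith

lemma exists_siegelRoot :
    ∃ θ : ℝ, IsSiegelRoot θ ∧ (∀ t : ℝ, IsSiegelRoot t → t = θ) ∧
      1.7336105 ≤ siegelConstant θ ∧ siegelConstant θ < 1.7336106 := by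
  obtain ⟨h1, h2, h3, h4⟩ := siegel_root_numerics
  have hcont : ContinuousOn siegelFun (Set.Icc 0.31448086 0.314480875) := fun t ht =>
    (hasDerivAt_siegelFun (lt_of_lt_of_le (by norm_num) ht.1)).continuousAt.continuousWithinAt
  obtain ⟨θ, ⟨hl, hu⟩, hθ⟩ := intermediate_value_Ioo (by norm_num) hcont ⟨h1, h2⟩
  have hθ0 : 0 < θ := lt_trans (by norm_num) hl
  have hθ1 : θ ≤ 1 := hu.le.trans (by norm_num)
  refine ⟨θ, ⟨hθ0, hθ⟩, fun t ht => ?_, ?_, ?_⟩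
  · by_cases ht1 : 1 ≤ t
    · exact absurd ht.2 (one_lt_siegelFun ht1).ne'
    · exact strictMonoOn_siegelFun.injOn ⟨ht.1, (not_le.1 ht1).le⟩ ⟨hθ0, hθ1⟩ (ht.2.trans hθ.symm)
  · exact (h4.trans (strictAntiOn_siegelConstant hθ0 (Set.mem_Ioi.2 (by norm_num)) hu)).le
  · exact (strictAntiOn_siegelConstant (Set.mem_Ioi.2 (by norm_num)) hθ0 hl).trans h3

/-! ### An upper bound for the discriminant of positive points -/

open Finset in
/-- Expanding the Vandermonde determinant in monic Laguerre polynomials, whose weighted values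
are bounded by `monicLaguerre_sq_mul_pow_le`, bounds the discriminant of positive points. The
crude estimate of a determinant by its Leibniz expansion costs only the factor `(m !) ^ 2`. -/
lemma prod_abs_sub_mul_prod_pow_le {m : ℕ} (a : ℕ) (y : Fin m → ℝ) (hy : ∀ i, 0 < y i) :
    (∏ i, ∏ j ∈ {i}ᶜ, |y j - y i|) * (∏ i, y i) ^ a ≤
      (m.factorial : ℝ) ^ 2 *
        (∏ k ∈ range m, (k.factorial : ℝ) * (k + a).factorial) * Real.exp (∑ i, y i) := by
  set h : ℕ → ℝ := fun k => (k.factorial : ℝ) * (k + a).factorial with hh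
  have hpos (k : ℕ) : 0 < h k := by positivity
  -- `w i ^ 2` is the Laguerre weight `y ^ a * exp (-y)` at `y i`.
  set w : Fin m → ℝ := fun i => √(y i ^ a / Real.exp (y i)) with hw
  set A : Matrix (Fin m) (Fin m) ℝ := Matrix.of fun i j =>
    w i * ((√(h j))⁻¹ * (monicLaguerre j a).eval (y i)) with hA
  have hentry (i j : Fin m) : AbsoluteValue.abs (A i j) ≤ 1 := by
    rw [AbsoluteValue.abs_apply, ← sq_le_one_iff_abs_le_one]
    have hb := monicLaguerre_sq_mul_pow_le j a (hy i).le
    have hy' := hy i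
    rw [hA, Matrix.of_apply, mul_pow, mul_pow, inv_pow, Real.sq_sqrt (hpos j).le, hw,
      Real.sq_sqrt (by positivity), ← div_eq_inv_mul, div_mul_div_comm,
      div_le_one (mul_pos (Real.exp_pos _) (hpos j))]
    linarith
  have hdet := Matrix.det_le hentry
  rw [AbsoluteValue.abs_apply, one_pow, nsmul_eq_mul, mul_one, Fintype.card_fin] at hdet
  have hV := Matrix.det_eval_matrixOfPolynomials_eq_det_vandermonde y
    (fun j : Fin m => monicLaguerre j a) (fun j => (monicLaguerre_monic_natDegree j a).2)
    (fun j => (monicLaguerre_monic_natDegree j a).1)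
  have hAdet : A.det = (∏ i, w i) * ((∏ j : Fin m, (√(h j))⁻¹) * (Matrix.vandermonde y).det) := by
    rw [hV, ← Matrix.det_mul_row, ← Matrix.det_mul_column]
    rfl
  have hsq : (Matrix.vandermonde y).det ^ 2 = ∏ i, ∏ j ∈ {i}ᶜ, |y j - y i| := by
    rw [← prod_prod_Ioi_mul_eq_prod_prod_off_diag, Matrix.det_vandermonde, ← prod_pow]
    refine prod_congr rfl fun i _ => ?_
    rw [← prod_pow]
    refine prod_congr rfl fun j _ => ?_
    rw [abs_sub_comm (y i), ← sq, sq_abs]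
  have hA2 : A.det ^ 2 ≤ (m.factorial : ℝ) ^ 2 := by
    rw [← sq_abs]
    exact pow_le_pow_left₀ (abs_nonneg _) hdet 2
  have hw2 : (∏ i, w i) ^ 2 = (∏ i, y i) ^ a / Real.exp (∑ i, y i) := by
    rw [← prod_pow, Real.exp_sum, ← prod_pow, ← prod_div_distrib]
    refine prod_congr rfl fun i _ => ?_
    have hy' := hy i
    rw [hw, Real.sq_sqrt (by positivity)]
  have hh2 : (∏ j : Fin m, (√(h j))⁻¹) ^ 2 = (∏ k ∈ range m, h k)⁻¹ := by
    rw [← prod_pow, ← Fin.prod_univ_eq_prod_range, ← prod_inv_distrib]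
    refine prod_congr rfl fun i _ => ?_
    rw [inv_pow, Real.sq_sqrt (hpos i).le]
  have hP : 0 < ∏ k ∈ range m, h k := prod_pos fun k _ => hpos k
  rw [hAdet, mul_pow, mul_pow, hsq, hw2, hh2] at hA2
  have hE := Real.exp_pos (∑ i, y i)
  rw [show ∀ p q D N : ℝ, N / p * (q⁻¹ * D) = D * N / (q * p) by intros; field_simp,
    div_le_iff₀ (by positivity)] at hA2
  linarith

open Finset in
/-- The logarithm of `prod_abs_sub_mul_prod_pow_le` for the points `t * y i`, when the product and
the discriminant of the points `y i` are at least `1`. -/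
lemma mul_log_le_of_one_le_prod {m : ℕ} (a : ℕ) (y : Fin m → ℝ) (hy : ∀ i, 0 < y i)
    (hN : 1 ≤ ∏ i, y i) (hD : 1 ≤ ∏ i, ∏ j ∈ {i}ᶜ, |y j - y i|) {t : ℝ} (ht : 0 < t) :
    (m : ℝ) * (m - 1 + a) * Real.log t ≤
      2 * Real.log m.factorial +
        ∑ k ∈ range m, (Real.log k.factorial + Real.log (k + a).factorial) + t * ∑ i, y i := by
  rcases Nat.eq_zero_or_pos m with rfl | hm
  · simp
  have h := prod_abs_sub_mul_prod_pow_le a (fun i => t * y i) fun i => mul_pos ht (hy i)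
  have hc (i : Fin m) : #({i}ᶜ : Finset (Fin m)) = m - 1 := by simp [card_compl]
  have e1 : ∏ i, ∏ j ∈ {i}ᶜ, |t * y j - t * y i| =
      t ^ ((m - 1) * m) * ∏ i, ∏ j ∈ {i}ᶜ, |y j - y i| := by
    simp_rw [← mul_sub, abs_mul, prod_mul_distrib, prod_const, hc, abs_of_pos ht]
    simp [← pow_mul]
  have e2 : ∏ i, t * y i = t ^ m * ∏ i, y i := by simp [prod_mul_distrib]
  rw [e1, e2, ← mul_sum] at h
  have hle : t ^ ((m - 1) * m) * (t ^ m) ^ a ≤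
      t ^ ((m - 1) * m) * (∏ i, ∏ j ∈ {i}ᶜ, |y j - y i|) * (t ^ m * ∏ i, y i) ^ a := by
    gcongr
    · exact le_mul_of_one_le_right (by positivity) hD
    · exact le_mul_of_one_le_right (by positivity) hN
  have hl := Real.log_le_log (by positivity) (hle.trans h)
  have hP : ∏ k ∈ range m, ((k.factorial : ℝ) * (k + a).factorial) ≠ 0 :=
    prod_ne_zero_iff.2 fun k _ => by positivity
  rw [Real.log_mul (by positivity) (by positivity), Real.log_mul (by positivity) (by positivity),
    Real.log_mul (by positivity) hP, Real.log_exp, Real.log_prod fun k _ => by positivity,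
    Real.log_pow, Real.log_pow, Real.log_pow, Real.log_pow] at hl
  have e3 : ∑ k ∈ range m, Real.log ((k.factorial : ℝ) * (k + a).factorial) =
      ∑ k ∈ range m, (Real.log k.factorial + Real.log (k + a).factorial) :=
    sum_congr rfl fun k _ => Real.log_mul (by positivity) (by positivity)
  rw [e3] at hl
  push_cast [Nat.cast_sub hm] at hl
  linarith

/-! ### Asymptotics of the discriminant bound -/

/-- The antiderivative of `v log v - v` that vanishes at `0`. -/
noncomputable def stirlingPrimitive (v : ℝ) : ℝ := v ^ 2 / 2 * Real.log v - 3 / 4 * v ^ 2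

lemma stirlingPrimitive_mul {m v : ℝ} (hm : 0 < m) (hv : 0 ≤ v) :
    stirlingPrimitive (m * v) = m ^ 2 * (stirlingPrimitive v + v ^ 2 / 2 * Real.log m) := by
  rcases hv.eq_or_lt with rfl | hv
  · simp [stirlingPrimitive]
  · rw [stirlingPrimitive, stirlingPrimitive, Real.log_mul hm.ne' hv.ne']
    ring

lemma log_factorial_le (k : ℕ) :
    Real.log k.factorial ≤ k * Real.log k - k + 1 + Real.log k := by
  induction k with
  | zero => simp
  | succ k ih =>
    rw [Nat.factorial_succ]
    push_cast
    rw [Real.log_mul (by positivity) (by positivity)]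
    rcases Nat.eq_zero_or_pos k with rfl | hk
    · norm_num
    · have hk' : (0 : ℝ) < k := by exact_mod_cast hk
      have h := inv_one_add_lt_log hk'
      rw [log_one_add_inv hk', inv_lt_iff_one_lt_mul₀' (by positivity), add_comm (1 : ℝ)] at h
      linarith

/-- Stirling's upper bound in telescoping form: `v log v - v` is increasing for `v ≥ 1`, so its
value at `k` is at most its integral over `[k, k + 1]`. -/
lemma log_factorial_le_sub (k : ℕ) :
    Real.log k.factorial ≤
      stirlingPrimitive (k + 1) - stirlingPrimitive k + 2 + Real.log (k + 1) := by
  have h := log_factorial_le k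
  have hlog : Real.log k ≤ Real.log (k + 1) := by
    rcases Nat.eq_zero_or_pos k with rfl | hk
    · simp
    · exact Real.log_le_log (by exact_mod_cast hk) (by linarith)
  suffices (k : ℝ) * Real.log k - k - 1 ≤ stirlingPrimitive (k + 1) - stirlingPrimitive k by
    linarith
  rcases Nat.eq_zero_or_pos k with rfl | hk
  · norm_num [stirlingPrimitive]
  · have hk' : (1 : ℝ) ≤ k := by exact_mod_cast hk
    have h0 := Real.log_nonneg hk'
    have h := inv_one_add_lt_log (t := k) (by linarith)
    rw [log_one_add_inv (by linarith), inv_lt_iff_one_lt_mul₀' (by positivity),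
      add_comm (1 : ℝ)] at h
    have h2 := mul_le_mul_of_nonneg_left h.le (show (0 : ℝ) ≤ (k + 1) / 2 by positivity)
    rw [stirlingPrimitive, stirlingPrimitive]
    linarith

open Finset in
lemma sum_log_factorial_le (m a : ℕ) :
    ∑ k ∈ range m, Real.log (k + a).factorial ≤
      stirlingPrimitive (m + a) - stirlingPrimitive a + m * (2 + Real.log (m + a)) := by
  have h : ∀ k ∈ range m, Real.log (k + a).factorial ≤
      (stirlingPrimitive ((k + 1 : ℕ) + a) - stirlingPrimitive ((k : ℕ) + a)) +
        (2 + Real.log (m + a)) := by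
    intro k hk
    have h1 := log_factorial_le_sub (k + a)
    have h2 : Real.log (((k + a : ℕ) : ℝ) + 1) ≤ Real.log (m + a) := by
      refine Real.log_le_log (by positivity) ?_
      have := mem_range.1 hk
      exact_mod_cast (by omega : k + a + 1 ≤ m + a)
    push_cast at *
    rw [show (k : ℝ) + 1 + a = k + a + 1 by ring]
    linarith
  refine (sum_le_sum h).trans ?_
  rw [sum_add_distrib, sum_range_sub (fun k : ℕ => stirlingPrimitive ((k : ℝ) + a))]
  simp [mul_add]

open Finset in
/-- The inequality `mul_log_le_of_one_le_prod` for `t = γ * m`, divided by `m ^ 2`; terms of order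
`m ^ 2 * log m` cancel. The limit of this bound, as `m` grows and `a / m` tends to a root `θ` of
Siegel's equation, is evaluated in `siegelRoot_identity`; the terms in the last parentheses tend
to `0`. -/
lemma le_mul_sum_div {m : ℕ} (hm : 0 < m) (a : ℕ) (y : Fin m → ℝ) (hy : ∀ i, 0 < y i)
    (hN : 1 ≤ ∏ i, y i) (hD : 1 ≤ ∏ i, ∏ j ∈ {i}ᶜ, |y j - y i|) {γ : ℝ} (hγ : 0 < γ) :
    (1 + a / m) * Real.log γ - stirlingPrimitive 1 - stirlingPrimitive (1 + a / m) +
        stirlingPrimitive (a / m) -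
        (5 * (Real.log m / m) + (Real.log γ + 4 + Real.log (1 + a / m)) / m) ≤
      γ * ((∑ i, y i) / m) := by
  have hm' : (0 : ℝ) < m := by exact_mod_cast hm
  obtain ⟨b, hb⟩ : ∃ b : ℝ, (a : ℝ) = m * b := ⟨a / m, by field_simp⟩
  have hb0 : 0 ≤ b := by
    by_contra! hlt
    nlinarith [Nat.cast_nonneg (α := ℝ) a]
  have h := mul_log_le_of_one_le_prod a y hy hN hD (t := γ * m) (by positivity)
  have h1 := sum_log_factorial_le m 0
  have h2 := sum_log_factorial_le m a
  have h3 : Real.log m.factorial ≤ m * Real.log m := by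
    rw [← Real.log_pow]
    exact Real.log_le_log (by positivity) (by exact_mod_cast Nat.factorial_le_pow m)
  rw [sum_add_distrib, Real.log_mul hγ.ne' hm'.ne'] at h
  have e1 := stirlingPrimitive_mul hm' (zero_le_one)
  have e2 := stirlingPrimitive_mul hm' (show 0 ≤ 1 + b by positivity)
  have e3 := stirlingPrimitive_mul hm' hb0
  have e4 : Real.log (m + m * b) = Real.log m + Real.log (1 + b) := by
    rw [← Real.log_mul hm'.ne' (by positivity)]
    ring_nf
  have e0 : stirlingPrimitive 0 = 0 := by simp [stirlingPrimitive]
  rw [mul_one] at e1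
  rw [show (m : ℝ) * (1 + b) = m + m * b by ring] at e2
  simp only [Nat.cast_zero, add_zero, e0, sub_zero, e1] at h1
  rw [hb, e2, e3, e4] at h2
  rw [hb, mul_div_cancel_left₀ _ hm'.ne'] at *
  refine le_of_mul_le_mul_left ?_ (pow_pos hm' 2)
  have r1 : (m : ℝ) ^ 2 * (γ * ((∑ i, y i) / m)) = γ * m * ∑ i, y i := by field_simp
  have r2 : (m : ℝ) ^ 2 * ((1 + b) * Real.log γ - stirlingPrimitive 1 - stirlingPrimitive (1 + b) +
        stirlingPrimitive b -
        (5 * (Real.log m / m) + (Real.log γ + 4 + Real.log (1 + b)) / m)) =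
      (m : ℝ) ^ 2 * ((1 + b) * Real.log γ - stirlingPrimitive 1 - stirlingPrimitive (1 + b) +
        stirlingPrimitive b) -
        m * (5 * Real.log m + (Real.log γ + 4 + Real.log (1 + b))) := by field_simp
  rw [r1, r2]
  nlinarith [h, h1, h2, h3]

/-- The value `γ = (1 + θ) / siegelConstant θ` maximises the left side divided by `γ`. -/
lemma siegelRoot_identity {θ : ℝ} (h : IsSiegelRoot θ) :
    (1 + θ) * Real.log ((1 + θ) / siegelConstant θ) - stirlingPrimitive 1 -
      stirlingPrimitive (1 + θ) + stirlingPrimitive θ = 1 + θ := by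
  obtain ⟨h0, h1⟩ := h
  have hne : 1 + θ ≠ 0 := by positivity
  have h2 : (1 + θ) ^ 2 * (Real.log (1 + θ) - Real.log θ) + Real.log θ = 1 + θ := by
    rw [log_one_add_inv h0] at h1
    field_simp at h1
    linarith
  rw [siegelConstant_eq_exp h0, Real.log_div hne (Real.exp_pos _).ne', Real.log_exp,
    log_one_add_inv h0]
  simp only [stirlingPrimitive, Real.log_one]
  linear_combination h2 / 2

open Finset Filter Topology in
/-- Siegel's trace bound, for points that need not be conjugate: it only uses that their norm and
their discriminant are at least `1`. -/
theorem siegel_trace_bound {θ lam : ℝ} (hθ : IsSiegelRoot θ) (hlam : lam < siegelConstant θ) :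
    ∃ M : ℕ, ∀ m : ℕ, M ≤ m → ∀ y : Fin m → ℝ, (∀ i, 0 < y i) → 1 ≤ ∏ i, y i →
      1 ≤ ∏ i, ∏ j ∈ {i}ᶜ, |y j - y i| → lam * m ≤ ∑ i, y i := by
  have h0 := hθ.1
  have hs : 0 < siegelConstant θ := by rw [siegelConstant_eq_exp h0]; exact Real.exp_pos _
  set γ := (1 + θ) / siegelConstant θ with hγdef
  have hγ : 0 < γ := by positivity
  have hcast : Tendsto (fun m : ℕ => (m : ℝ)) atTop atTop := tendsto_natCast_atTop_atTop
  have hb : Tendsto (fun m : ℕ => (⌊θ * m⌋₊ : ℝ) / m) atTop (𝓝 θ) :=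
    (tendsto_nat_floor_mul_div_atTop h0.le).comp hcast
  have hc (v : ℝ) (hv : 0 < v) : ContinuousAt stirlingPrimitive v := by
    unfold stirlingPrimitive
    fun_prop (disch := exact hv.ne')
  have hlog : Tendsto (fun m : ℕ => Real.log m / m) atTop (𝓝 0) :=
    (Real.isLittleO_log_id_atTop.tendsto_div_nhds_zero).comp hcast
  have hb1 := hb.const_add 1
  have ht : Tendsto (fun m : ℕ => (1 + (⌊θ * m⌋₊ : ℝ) / m) * Real.log γ - stirlingPrimitive 1 -
        stirlingPrimitive (1 + (⌊θ * m⌋₊ : ℝ) / m) + stirlingPrimitive ((⌊θ * m⌋₊ : ℝ) / m) -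
        (5 * (Real.log m / m) +
          (Real.log γ + 4 + Real.log (1 + (⌊θ * m⌋₊ : ℝ) / m)) / m)) atTop
      (𝓝 ((1 + θ) * Real.log γ - stirlingPrimitive 1 - stirlingPrimitive (1 + θ) +
        stirlingPrimitive θ - (5 * 0 + 0))) :=
    ((((hb1.mul_const _).sub_const _).sub ((hc _ (by positivity)).tendsto.comp hb1)).add
      ((hc θ h0).tendsto.comp hb)).sub ((hlog.const_mul 5).add
        (((hb1.log (by positivity)).const_add _).div_atTop hcast))
  rw [siegelRoot_identity hθ] at ht
  have hlt : γ * lam < 1 + θ - (5 * 0 + 0) := by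
    have : γ * siegelConstant θ = 1 + θ := by rw [hγdef]; field_simp
    have := mul_lt_mul_of_pos_left hlam hγ
    linarith
  obtain ⟨M, hM⟩ := eventually_atTop.1 ((ht.eventually_const_lt hlt).and (eventually_gt_atTop 0))
  refine ⟨M, fun m hm y hy hN hD => ?_⟩
  obtain ⟨h1, hm0⟩ := hM m hm
  have h2 := h1.le.trans (le_mul_sum_div hm0 ⌊θ * m⌋₊ y hy hN hD hγ)
  rw [← le_div_iff₀ (by exact_mod_cast hm0)]
  exact le_of_mul_le_mul_left h2 hγ

/-- A symmetric integer polynomial takes an integer value at the roots of a monic integer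
polynomial. -/
lemma exists_int_eq_aeval_of_isSymmetric {n : ℕ} {p : ℤ[X]} {x : Fin n → ℝ}
    (hp : p.map (Int.castRingHom ℝ) = ∏ i, (X - C (x i)))
    {Q : MvPolynomial (Fin n) ℤ} (hQ : Q.IsSymmetric) :
    ∃ z : ℤ, MvPolynomial.aeval x Q = z := by
  obtain ⟨R, hR⟩ := MvPolynomial.esymmAlgHom_fin_surjective ℤ le_rfl ⟨Q, hQ⟩
  have hcoeff (i : Fin n) :
      ∃ z : ℤ, MvPolynomial.aeval x (MvPolynomial.esymm (Fin n) ℤ (i + 1)) = z := by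
    have hi : n - ((i : ℕ) + 1) ≤ Multiset.card (Finset.univ.val.map x) := by simp
    have h := Multiset.prod_X_sub_C_coeff (Finset.univ.val.map x) hi
    rw [Multiset.map_map] at h
    change (∏ i, (X - C (x i))).coeff _ = _ at h
    have hsub : n - (n - ((i : ℕ) + 1)) = i + 1 := by omega
    rw [← hp, coeff_map, Multiset.card_map, Finset.card_val, Finset.card_univ, Fintype.card_fin,
      hsub] at h
    refine ⟨(-1) ^ ((i : ℕ) + 1) * p.coeff (n - ((i : ℕ) + 1)), ?_⟩
    rw [MvPolynomial.aeval_esymm_eq_multiset_esymm]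
    push_cast
    rw [eq_intCast] at h
    rw [h, ← mul_assoc, ← mul_pow]
    simp
  choose z hz using hcoeff
  refine ⟨MvPolynomial.aeval z R, ?_⟩
  have h : Q = MvPolynomial.aeval
      (fun i : Fin n => MvPolynomial.esymm (Fin n) ℤ (i + 1)) R := by
    rw [← MvPolynomial.esymmAlgHom_apply, hR]
  rw [h, MvPolynomial.comp_aeval_apply]
  simp_rw [hz]
  exact MvPolynomial.aeval_algebraMap_apply ℝ z R

lemma one_le_abs_aeval_of_isSymmetric {n : ℕ} {p : ℤ[X]} {x : Fin n → ℝ}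
    (hp : p.map (Int.castRingHom ℝ) = ∏ i, (X - C (x i)))
    {Q : MvPolynomial (Fin n) ℤ} (hQ : Q.IsSymmetric) (h0 : MvPolynomial.aeval x Q ≠ 0) :
    1 ≤ |MvPolynomial.aeval x Q| := by
  obtain ⟨z, hz⟩ := exists_int_eq_aeval_of_isSymmetric hp hQ
  rw [hz] at h0 ⊢
  exact_mod_cast Int.one_le_abs (by exact_mod_cast h0)

/-! ### The squared differences as points indexed by pairs -/

/-- The unordered pairs of distinct indices. -/
abbrev IndexPair (n : ℕ) : Type := {P : Sym2 (Fin n) // ¬ P.IsDiag}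

/-- The function `(x_i - x_j)²` of the unordered pair of indices `i`, `j`. -/
def sqDiff {n : ℕ} {R : Type*} [CommRing R] (x : Fin n → R) : Sym2 (Fin n) → R :=
  Sym2.lift ⟨fun i j => (x i - x j) ^ 2, fun i j => by ring⟩

@[simp] lemma sqDiff_mk {n : ℕ} {R : Type*} [CommRing R] (x : Fin n → R) (i j : Fin n) :
    sqDiff x s(i, j) = (x i - x j) ^ 2 := rfl

lemma map_sqDiff {n : ℕ} {R S F : Type*} [CommRing R] [CommRing S] [FunLike F R S]
    [RingHomClass F R S] (f : F) (x : Fin n → R) (P : Sym2 (Fin n)) :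
    f (sqDiff x P) = sqDiff (fun i => f (x i)) P := by
  induction P with | _ i j => simp

lemma sqDiff_comp {n : ℕ} {R : Type*} [CommRing R] (x : Fin n → R) (σ : Fin n → Fin n)
    (P : Sym2 (Fin n)) : sqDiff (fun i => x (σ i)) P = sqDiff x (P.map σ) := by
  induction P with | _ i j => simp

/-- The action of a permutation of the indices on the pairs of distinct indices. -/
def IndexPair.perm {n : ℕ} (σ : Equiv.Perm (Fin n)) : Equiv.Perm (IndexPair n) where
  toFun P := ⟨P.1.map σ, by rw [Sym2.isDiag_map σ.injective]; exact P.2⟩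
  invFun P := ⟨P.1.map σ.symm, by rw [Sym2.isDiag_map σ.symm.injective]; exact P.2⟩
  left_inv P := by ext1; simp [Sym2.map_map]
  right_inv P := by ext1; simp [Sym2.map_map]

lemma rename_sqDiff {n : ℕ} (σ : Equiv.Perm (Fin n)) (P : IndexPair n) :
    MvPolynomial.rename σ (sqDiff (MvPolynomial.X (R := ℤ)) P.1) =
      sqDiff MvPolynomial.X (IndexPair.perm σ P).1 := by
  rw [map_sqDiff]
  simp only [MvPolynomial.rename_X]
  exact sqDiff_comp _ _ _

lemma isSymmetric_prod_sqDiff (n : ℕ) :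
    (∏ P : IndexPair n, sqDiff (MvPolynomial.X (R := ℤ)) P.1).IsSymmetric := by
  intro σ
  simp_rw [map_prod, rename_sqDiff]
  exact Equiv.prod_comp (IndexPair.perm σ) fun P => sqDiff (MvPolynomial.X (R := ℤ)) P.1

open Finset in
lemma isSymmetric_prod_sqDiff_sub (n : ℕ) :
    (∏ P : IndexPair n, ∏ Q ∈ {P}ᶜ, (sqDiff (MvPolynomial.X (R := ℤ)) Q.1 -
      sqDiff MvPolynomial.X P.1)).IsSymmetric := by
  intro σ
  simp_rw [map_prod, map_sub, rename_sqDiff]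
  rw [← Equiv.prod_comp (IndexPair.perm σ) fun P => ∏ Q ∈ {P}ᶜ,
    (sqDiff (MvPolynomial.X (R := ℤ)) Q.1 - sqDiff MvPolynomial.X P.1)]
  refine prod_congr rfl fun P _ => ?_
  exact prod_equiv (IndexPair.perm σ) (by simp) (fun _ _ => rfl)

open Finset in
lemma sum_sqDiff_eq_potentialEnergy {n : ℕ} (x : Fin n → ℝ) :
    ∑ P : IndexPair n, sqDiff x P.1 = potentialEnergy x := by
  rw [← Finset.sum_subtype (univ.filter fun P : Sym2 (Fin n) => ¬ P.IsDiag) (by simp) (sqDiff x),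
    ← sym2_univ, sum_sym2_filter_not_isDiag, potentialEnergy]
  refine sum_congr ?_ fun q _ => rfl
  ext q
  simp only [mem_filter, mem_offDiag, mem_univ, true_and, and_iff_right_iff_imp]
  exact fun h => h.ne

lemma exists_lt_eq_mk {n : ℕ} (P : IndexPair n) : ∃ i j : Fin n, i < j ∧ P.1 = s(i, j) := by
  obtain ⟨P, hP⟩ := P
  induction P with
  | _ i j =>
    rcases lt_trichotomy i j with h | h | h
    · exact ⟨i, j, h, rfl⟩
    · exact absurd h hP
    · exact ⟨j, i, h, Sym2.eq_swap⟩

lemma injective_sqDiff {n : ℕ} {x : Fin n → ℝ}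
    (h : ∀ i j k l : Fin n, i < j → k < l →
      (x i - x j) ^ 2 = (x k - x l) ^ 2 → i = k ∧ j = l) :
    Function.Injective fun P : IndexPair n => sqDiff x P.1 := by
  intro P Q hPQ
  obtain ⟨i, j, hij, hP⟩ := exists_lt_eq_mk P
  obtain ⟨k, l, hkl, hQ⟩ := exists_lt_eq_mk Q
  simp only [hP, hQ, sqDiff_mk] at hPQ
  obtain ⟨rfl, rfl⟩ := h i j k l hij hkl hPQ
  exact Subtype.ext (hP.trans hQ.symm)

/-- With a third index `k`, a coincidence `x i = x j` would make the squared differences of the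
pairs `{i, k}` and `{j, k}` equal. -/
lemma injective_of_injective_sqDiff {n : ℕ} (hn : 3 ≤ n) {x : Fin n → ℝ}
    (h : Function.Injective fun P : IndexPair n => sqDiff x P.1) : Function.Injective x := by
  intro i j hij
  obtain ⟨k, hk⟩ : ∃ k, k ∉ ({i, j} : Finset (Fin n)) := by
    refine Finset.exists_mem_notMem_of_card_lt_card (t := Finset.univ) ?_ |>.imp fun k hk => hk.2
    rw [Finset.card_univ, Fintype.card_fin]
    exact lt_of_le_of_lt Finset.card_le_two (by omega)
  simp only [Finset.mem_insert, Finset.mem_singleton, not_or] at hk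
  have := @h ⟨s(i, k), fun e => hk.1 (Sym2.mk_isDiag_iff.1 e).symm⟩
    ⟨s(j, k), fun e => hk.2 (Sym2.mk_isDiag_iff.1 e).symm⟩ (by simp [hij])
  rw [Subtype.mk.injEq, Sym2.eq_iff] at this
  exact this.elim And.left fun h => absurd h.1.symm hk.1

/-! ### The lower bound for the potential energy -/

open Finset in
theorem proposition1p6 :
    ∃ θ : ℝ, IsSiegelRoot θ ∧ (∀ t : ℝ, IsSiegelRoot t → t = θ) ∧
      1.7336105 ≤ siegelConstant θ ∧ siegelConstant θ < 1.7336106 ∧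
      ∀ lam : ℝ, lam < siegelConstant θ →
        ∃ N : ℕ, ∀ n : ℕ, N ≤ n →
          ∀ (p : ℤ[X]) (x : Fin n → ℝ),
            p.Monic → Irreducible p →
            p.map (Int.castRingHom ℝ) = ∏ i : Fin n, (X - C (x i)) →
            (∀ i : Fin n, 0 < x i) →
            (∀ i j k l : Fin n, i < j → k < l →
              (x i - x j) ^ 2 = (x k - x l) ^ 2 → i = k ∧ j = l) →
            lam * (n.choose 2 : ℝ) ≤ potentialEnergy x := by
  obtain ⟨θ, hθ, huniq, hl, hu⟩ := exists_siegelRoot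
  refine ⟨θ, hθ, huniq, hl, hu, fun lam hlam => ?_⟩
  obtain ⟨M, hM⟩ := siegel_trace_bound hθ hlam
  -- `n ≥ 3` makes the roots distinct, and `n.choose 2 ≥ n - 1 ≥ M`.
  refine ⟨M + 3, fun n hn p x _ _ hp _ hx => ?_⟩
  have hinj := injective_sqDiff hx
  have hxinj := injective_of_injective_sqDiff (by omega) hinj
  have hpos (P : IndexPair n) : 0 < sqDiff x P.1 := by
    obtain ⟨i, j, hij, hP⟩ := exists_lt_eq_mk P
    rw [hP, sqDiff_mk]
    have := sub_ne_zero.2 (hxinj.ne hij.ne)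
    positivity
  have hX (P : IndexPair n) :
      MvPolynomial.aeval x (sqDiff (MvPolynomial.X (R := ℤ)) P.1) = sqDiff x P.1 := by
    rw [map_sqDiff]
    simp
  have hN : 1 ≤ ∏ P : IndexPair n, sqDiff x P.1 := by
    have h := one_le_abs_aeval_of_isSymmetric hp (isSymmetric_prod_sqDiff n)
    simp_rw [map_prod, hX] at h
    have h0 : 0 < ∏ P : IndexPair n, sqDiff x P.1 := prod_pos fun P _ => hpos P
    rw [abs_of_pos h0] at h
    exact h h0.ne'
  have hD : 1 ≤ ∏ P : IndexPair n, ∏ Q ∈ {P}ᶜ, |sqDiff x Q.1 - sqDiff x P.1| := by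
    have h := one_le_abs_aeval_of_isSymmetric hp (isSymmetric_prod_sqDiff_sub n)
    simp_rw [map_prod, map_sub, hX, abs_prod] at h
    refine h (prod_ne_zero_iff.2 fun P _ => prod_ne_zero_iff.2 fun Q hQ => ?_)
    rw [mem_compl, mem_singleton] at hQ
    exact sub_ne_zero.2 (hinj.ne hQ)
  have hcard : Fintype.card (IndexPair n) = n.choose 2 := by
    rw [Sym2.card_subtype_not_diag, Fintype.card_fin]
  obtain e : Fin (n.choose 2) ≃ IndexPair n := (Fintype.equivFinOfCardEq hcard).symm
  have hMn : M ≤ n.choose 2 := by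
    have h1 : (n - 1 + 1).choose (1 + 1) = _ := Nat.choose_succ_succ (n - 1) 1
    rw [Nat.choose_one_right, show n - 1 + 1 = n by omega] at h1
    change n.choose 2 = _ at h1
    omega
  rw [← sum_sqDiff_eq_potentialEnergy, ← e.sum_comp]
  refine hM _ hMn (fun k => sqDiff x (e k).1) (fun k => hpos _) ?_ ?_
  · rwa [e.prod_comp fun P : IndexPair n => sqDiff x P.1]
  · rw [← e.prod_comp] at hD
    convert hD using 3 with k
    exact prod_equiv e (by simp) fun _ _ => rfl
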